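/- Let $A \to A'$ be a homomorphism of commutative rings with identity, let $M$ be an $A$-module, let $n \geq 0$ be an integer, and put $M' = M \otimes_A A'$. For a commutative ring $R$ and an $R$-module $N$, let $\mathrm{T}^n_R(N) = N \otimes_R \cdots \otimes_R N$ ($n$ factors) with the $R$-linear action of the symmetric group $\mathfrak{S}_n$ given by $\sigma(x_1 \otimes \cdots \otimes x_n) = x_{\sigma^{-1}(1)} \otimes \cdots \otimes x_{\sigma^{-1}(n)}$, and let $\mathrm{TS}^n_R(N) = \mathrm{T}^n_R(N)^{\mathfrak{S}_n}$ be the submodule of invariants (the symmetric tensors). The natural isomorphism $\mathrm{T}^n_A(M) \otimes_A A' \to \mathrm{T}^n_{A'}(M')$, $(m_1 \otimes \cdots \otimes m_n) \otimes a' \mapsto a' \cdot \big((m_1 \otimes 1) \otimes \cdots \otimes (m_n \otimes 1)\big)$, induces a canonical $A'$-linear base change map \[ \mathrm{TS}^n_A(M) \otimes_A A' \longrightarrow \mathrm{TS}^n_{A'}(M'). \] This base change map is an isomorphism in each of the following cases: (i) the element $n!$ is invertible in the ring $A$; (ii) the $A$-module $M$ is flat; (iii) the base extension $A \to A'$ is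 flat. -/

import Mathlib

open scoped TensorProduct

/-- The action of the symmetric group on the `n`-fold tensor power `M ⊗ ⋯ ⊗ M` over `A`, with
`σ (m₁ ⊗ ⋯ ⊗ mₙ) = m_{σ⁻¹(1)} ⊗ ⋯ ⊗ m_{σ⁻¹(n)}` (see `permAction_tprod`). -/
noncomputable def permAction (A : Type*) [CommRing A] (M : Type*) [AddCommGroup M] [Module A M]
    (n : ℕ) : Representation A (Equiv.Perm (Fin n)) (⨂[A]^n M) where
  toFun σ := (PiTensorProduct.reindex A (fun _ : Fin n => M) σ).toLinearMap
  map_one' := by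
    refine PiTensorProduct.ext (MultilinearMap.ext fun m => ?_)
    exact PiTensorProduct.reindex_tprod _ _
  map_mul' σ τ := by
    refine PiTensorProduct.ext (MultilinearMap.ext fun m => ?_)
    have h : PiTensorProduct.reindex A (fun _ : Fin n => M) σ
        (PiTensorProduct.reindex A (fun _ : Fin n => M) τ (⨂ₜ[A] i, m i)) =
        ⨂ₜ[A] i, m (τ.symm (σ.symm i)) :=
      (congrArg (PiTensorProduct.reindex A (fun _ : Fin n => M) σ)
        (PiTensorProduct.reindex_tprod τ m)).trans
        (PiTensorProduct.reindex_tprod σ fun i => m (τ.symm i))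
    exact (PiTensorProduct.reindex_tprod (σ * τ) m).trans h.symm

theorem permAction_tprod (A : Type*) [CommRing A] (M : Type*) [AddCommGroup M] [Module A M]
    (n : ℕ) (σ : Equiv.Perm (Fin n)) (m : Fin n → M) :
    permAction A M n σ (⨂ₜ[A] i, m i) = ⨂ₜ[A] i, m (σ⁻¹ i) :=
  PiTensorProduct.reindex_tprod σ m

/-- The module `TSⁿ_A(M)` of symmetric tensors: the tensors in the `n`-fold tensor power of `M`
that are invariant under the action of the symmetric group. -/
noncomputable def symmetricTensors (A : Type*) [CommRing A] (M : Type*) [AddCommGroup M]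
    [Module A M] (n : ℕ) : Submodule A (⨂[A]^n M) :=
  (permAction A M n).invariants

/-- The natural `A'`-linear map `Tⁿ_A(M) ⊗ A' → Tⁿ_{A'}(M ⊗ A')` sending
`a' ⊗ (m₁ ⊗ ⋯ ⊗ mₙ)` to `a' • ((1 ⊗ m₁) ⊗ ⋯ ⊗ (1 ⊗ mₙ))`. -/
noncomputable def tensorPowerBaseChange (A : Type*) [CommRing A] (A' : Type*) [CommRing A']
    [Algebra A A'] (M : Type*) [AddCommGroup M] [Module A M] (n : ℕ) :
    A' ⊗[A] (⨂[A]^n M) →ₗ[A'] ⨂[A']^n (A' ⊗[A] M) :=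
  LinearMap.liftBaseChange A' (PiTensorProduct.lift
    (((PiTensorProduct.tprod A' (s := fun _ : Fin n => A' ⊗[A] M)).restrictScalars
      A).compLinearMap (fun _ => TensorProduct.mk A A' M 1)))

theorem tensorPowerBaseChange_tmul_tprod (A : Type*) [CommRing A] (A' : Type*) [CommRing A']
    [Algebra A A'] (M : Type*) [AddCommGroup M] [Module A M] (n : ℕ) (a : A') (m : Fin n → M) :
    tensorPowerBaseChange A A' M n (a ⊗ₜ[A] (⨂ₜ[A] i, m i)) =
      a • ⨂ₜ[A'] i, ((1 : A') ⊗ₜ[A] m i) := by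
  simp [tensorPowerBaseChange]

theorem permAction_tensorPowerBaseChange (A : Type*) [CommRing A] (A' : Type*) [CommRing A']
    [Algebra A A'] (M : Type*) [AddCommGroup M] [Module A M] (n : ℕ)
    (σ : Equiv.Perm (Fin n)) (a : A') (x : ⨂[A]^n M) :
    permAction A' (A' ⊗[A] M) n σ (tensorPowerBaseChange A A' M n (a ⊗ₜ[A] x)) =
      tensorPowerBaseChange A A' M n (a ⊗ₜ[A] permAction A M n σ x) := by
  induction x using PiTensorProduct.induction_on with
  | smul_tprod r m =>
    simp only [map_smul, permAction_tprod, ← TensorProduct.smul_tmul,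
      tensorPowerBaseChange_tmul_tprod]
  | add x y hx hy => simp only [map_add, TensorProduct.tmul_add, hx, hy]

/-- The canonical base change map `TSⁿ_A(M) ⊗ A' → TSⁿ_{A'}(M ⊗ A')`, induced by
`tensorPowerBaseChange`. -/
noncomputable def symmetricTensorsBaseChange (A : Type*) [CommRing A] (A' : Type*) [CommRing A']
    [Algebra A A'] (M : Type*) [AddCommGroup M] [Module A M] (n : ℕ) :
    A' ⊗[A] symmetricTensors A M n →ₗ[A'] symmetricTensors A' (A' ⊗[A] M) n :=
  LinearMap.codRestrict (symmetricTensors A' (A' ⊗[A] M) n)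
    (tensorPowerBaseChange A A' M n ∘ₗ (symmetricTensors A M n).subtype.baseChange A') (by
      intro x
      induction x using TensorProduct.induction_on with
      | zero => rw [map_zero]; exact Submodule.zero_mem _
      | add x y hx hy => rw [map_add]; exact Submodule.add_mem _ hx hy
      | tmul a x =>
        intro σ
        change permAction A' (A' ⊗[A] M) n σ (tensorPowerBaseChange A A' M n
          (a ⊗ₜ[A] (x : ⨂[A]^n M))) = tensorPowerBaseChange A A' M n (a ⊗ₜ[A] (x : ⨂[A]^n M))
        rw [permAction_tensorPowerBaseChange, x.2 σ])

theorem symmetricTensorsBaseChange_tmul (A : Type*) [CommRing A] (A' : Type*) [CommRing A']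
    [Algebra A A'] (M : Type*) [AddCommGroup M] [Module A M] (n : ℕ) (a : A')
    (x : symmetricTensors A M n) :
    (symmetricTensorsBaseChange A A' M n (a ⊗ₜ[A] x) : ⨂[A']^n (A' ⊗[A] M)) =
      tensorPowerBaseChange A A' M n (a ⊗ₜ[A] (x : ⨂[A]^n M)) :=
  rfl

/-!
Put `T = Tⁿ_A(M)` with its action of `G = 𝔖ₙ`. Since `A' ⊗ T → Tⁿ_{A'}(A' ⊗ M)` is an equivariant
isomorphism (`tensorPowerBaseChange_bijective`), the base change map of symmetric tensors is
bijective as soon as tensoring with `A'` commutes with the formation of the invariants of `T`; this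
property is `TensorInvariants`, stated for an arbitrary module `N` in place of `A'`.

* If `N` is flat, the property holds because `T^G` is the kernel of `T → (G → T)`,
  `t ↦ (g t - t)_g`.
* If there are endomorphisms `c g` of `T` with `∑ g, c g = 1` such that `∑ g, c g ∘ g` takes values
  in `T^G`, this weighted average is a projection onto the invariants, and remains one after
  tensoring with `N` (`TensorInvariants.of_weighted_average`). If `n!` is invertible, take
  `c g = 1 / n!`.
* If `M` is free, `G` permutes a basis of `T`. Choose an element `s x` of `G` that carries a
  representative of the orbit of the basis element `x` to `x`, and let `c g` be the coordinate
  projection onto the span of all `x` with `s x = g` (`TensorInvariants.of_basis`).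

A flat module `M` is reduced to a free one as follows. Let `π : P → M` be surjective with `P` free.
The kernel of `Tⁿ(P) → Tⁿ(M)` is spanned by the pure tensors that have an entry in `ker π`
(`ker_tensorPowerMap_le`). So if an element of `N ⊗ Tⁿ(P)` dies in `N ⊗ Tⁿ(M)`, this is due to
finitely many elements of `ker π`, and by flatness these are killed by an endomorphism `α` of `P`
with `π ∘ α = π` (`exists_comp_eq_and_apply_eq_zero_of_flat`): any such element of `N ⊗ Tⁿ(P)` is
killed by `Tⁿ(α)` for a suitable `α` over `M`. This makes it possible to lift invariant
elements to invariant elements, and to deduce injectivity for `M` from injectivity for `P`.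
-/

/-! ### Invariants of a representation after tensoring -/

/-- The formation of the invariants of `ρ` commutes with tensoring by `N`: the map
`N ⊗ V^G → N ⊗ V` is injective, and its range consists of all elements that are fixed by `G`. -/
def TensorInvariants {A G V : Type*} [CommRing A] [Group G] [AddCommGroup V] [Module A V]
    (ρ : Representation A G V) (N : Type*) [AddCommGroup N] [Module A N] : Prop :=
  Function.Injective (ρ.invariants.subtype.lTensor N) ∧
    ∀ y : N ⊗[A] V, (∀ g, (ρ g).lTensor N y = y) → y ∈ LinearMap.range
      (ρ.invariants.subtype.lTensor N)

namespace TensorInvariants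

variable {A G V : Type*} [CommRing A] [Group G] [AddCommGroup V] [Module A V]
  (ρ : Representation A G V) (N : Type*) [AddCommGroup N] [Module A N]

/-- A weighted average `∑ g, c g ∘ ρ g`, whose weights `c g` are endomorphisms of `V` with sum `1`,
fixes the invariants of `ρ` and still does so after tensoring with `N`. If it takes
values in the invariants, it is therefore a projection onto them that is compatible with tensoring. -/
theorem of_weighted_average [Fintype G] (c : G → Module.End A V) (hc : ∑ g, c g = 1)
    (h : ∀ v, (∑ g, c g ∘ₗ ρ g) v ∈ ρ.invariants) : TensorInvariants ρ N := by
  set e : V →ₗ[A] V := ∑ g, c g ∘ₗ ρ g with he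
  let r : V →ₗ[A] ρ.invariants := e.codRestrict _ h
  have hr : ρ.invariants.subtype ∘ₗ r = e := rfl
  have hr' : r ∘ₗ ρ.invariants.subtype = LinearMap.id := by
    ext v
    have := LinearMap.congr_fun hc (v : V)
    have hv : ∀ g, ρ g (v : V) = v := v.2
    simpa [r, he, hv] using this
  constructor
  · refine Function.LeftInverse.injective (g := r.lTensor N) fun x => ?_
    rw [← LinearMap.lTensor_comp_apply, hr', LinearMap.lTensor_id_apply]
  · intro y hy
    refine ⟨r.lTensor N y, ?_⟩
    have key : (∑ g, c g).lTensor N y = e.lTensor N y := by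
      rw [he, ← LinearMap.coe_lTensorHom, map_sum, map_sum, LinearMap.sum_apply,
        LinearMap.sum_apply]
      refine Finset.sum_congr rfl fun g _ => ?_
      rw [LinearMap.coe_lTensorHom, LinearMap.lTensor_comp_apply, hy]
    rw [← LinearMap.lTensor_comp_apply, hr, ← key, hc]
    exact LinearMap.lTensor_id_apply N V y

/-- The weights are all `1 / |G|`. -/
theorem of_isUnit_card [Fintype G] (h : IsUnit (Fintype.card G : A)) : TensorInvariants ρ N := by
  obtain ⟨u, hu⟩ := h
  refine of_weighted_average ρ N (fun _ => (↑u⁻¹ : A) • 1) ?_ fun v g => ?_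
  · rw [Finset.sum_const, Finset.card_univ, ← Nat.cast_smul_eq_nsmul A, smul_smul, ← hu,
      Units.mul_inv, one_smul]
  · simp only [LinearMap.sum_apply, LinearMap.comp_apply, LinearMap.smul_apply, map_sum, map_smul,
      Module.End.one_apply]
    refine Fintype.sum_equiv (Equiv.mulLeft g) _ _ fun x => ?_
    rw [Equiv.coe_mulLeft, map_mul, Module.End.mul_apply]

/-- The invariants are the kernel of `V → (G → V)`, `v ↦ (g v - v)_g`. -/
theorem of_flat [Finite G] [Module.Flat A N] : TensorInvariants ρ N := by
  classical
  have := Fintype.ofFinite G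
  refine ⟨Module.Flat.lTensor_preserves_injective_linearMap _ (Submodule.subtype_injective _),
    fun y hy => ?_⟩
  let f : V →ₗ[A] (G → V) := LinearMap.pi fun g => ρ g - LinearMap.id
  have hf : f = ∑ g, LinearMap.single A (fun _ : G => V) g ∘ₗ (ρ g - LinearMap.id) := by
    ext v g
    simp [f, Finset.sum_apply, Pi.single_apply]
  have hex : Function.Exact ρ.invariants.subtype f := by
    intro v
    simp only [Submodule.subtype_apply, Set.mem_range,
      Subtype.exists, exists_prop, exists_eq_right]
    simp [f, funext_iff, sub_eq_zero, Representation.mem_invariants]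
  refine (Module.Flat.lTensor_exact N hex y).1 ?_
  rw [hf, ← LinearMap.coe_lTensorHom, map_sum, LinearMap.sum_apply]
  refine Finset.sum_eq_zero fun g _ => ?_
  rw [LinearMap.coe_lTensorHom, LinearMap.lTensor_comp_apply, LinearMap.lTensor_sub,
    LinearMap.sub_apply, hy, LinearMap.lTensor_id_apply, sub_self, map_zero]

/-- For a permutation representation choose for every `x` in the basis an element `s x` of the group
such that `(s x)⁻¹ • x` depends only on the orbit of `x`. Giving `g` as weight the projection onto
the span of all `x` with `s x = g` yields a weighted average that replaces every coordinate by the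
one at the chosen representative of its orbit. -/
theorem of_basis [Finite G] {X : Type*} [MulAction G X] (b : Module.Basis X A V)
    (hb : ∀ g x, ρ g (b x) = b (g • x)) : TensorInvariants ρ N := by
  classical
  have := Fintype.ofFinite G
  let rep : X → X := fun x => (Quotient.mk (MulAction.orbitRel G X) x).out
  have hrep : ∀ x, ∃ g : G, g • rep x = x := fun x => by
    have h : (MulAction.orbitRel G X).r (rep x) x := Quotient.exact (Quotient.out_eq _)
    obtain ⟨g, hg⟩ := MulAction.mem_orbit_iff.1 (MulAction.orbitRel_apply.1 h)
    exact ⟨g⁻¹, by rw [← hg, inv_smul_smul]⟩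
  have hrep_smul : ∀ (g : G) x, rep (g • x) = rep x := fun g x => by
    have : (Quotient.mk (MulAction.orbitRel G X) (g • x)) = Quotient.mk _ x :=
      Quotient.sound (MulAction.orbitRel_apply.2 ⟨g, rfl⟩)
    simp only [rep, this]
  choose s hs using hrep
  have hs' : ∀ x, (s x)⁻¹ • x = rep x := fun x => by rw [inv_smul_eq_iff, hs]
  have hρ : ∀ g v x, b.repr (ρ g v) x = b.repr v (g⁻¹ • x) := fun g v x => by
    have : b.coord x ∘ₗ ρ g = b.coord (g⁻¹ • x) := b.ext fun z => by
      simp [hb, Finsupp.single_apply, eq_inv_smul_iff]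
    exact LinearMap.congr_fun this v
  let c : G → Module.End A V := fun g => b.constr A fun x => if s x = g then b x else 0
  have hcr : ∀ g v x, b.repr (c g v) x = if s x = g then b.repr v x else 0 := fun g v x => by
    have : b.coord x ∘ₗ c g = if s x = g then b.coord x else 0 := b.ext fun z => by
      by_cases hz : z = x
      · subst hz
        by_cases h : s z = g <;> simp [c, h]
      · by_cases h : s z = g <;> by_cases h' : s x = g <;> simp [c, h, h', hz]
    have h2 := LinearMap.congr_fun this v
    by_cases h : s x = g <;> simpa [h] using h2
  have he : ∀ v x, b.repr ((∑ g, c g ∘ₗ ρ g) v) x = b.repr v (rep x) := fun v x => by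
    simp [LinearMap.sum_apply, map_sum, Finsupp.finsetSum_apply, hcr, hρ, hs']
  refine of_weighted_average ρ N c ?_ fun v g => ?_
  · refine b.ext fun x => ?_
    simp [c, LinearMap.sum_apply]
  · refine b.ext_elem fun x => ?_
    rw [hρ, he, he, hrep_smul]

end TensorInvariants

/-! ### Base change of tensor powers -/

instance MultilinearMap.isScalarTower_of_algebra {A A' ι V W : Type*} [CommRing A] [CommRing A']
    [Algebra A A'] [AddCommGroup V] [Module A' V] [AddCommGroup W] [Module A W] [Module A' W]
    [IsScalarTower A A' W] :
    IsScalarTower A A' (MultilinearMap A' (fun _ : ι => V) W) :=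
  ⟨fun _ _ _ => MultilinearMap.ext fun _ => smul_assoc _ _ _⟩

/-- The extension of an `A`-multilinear map `f` on `M` with values in an `A'`-module to an
`A'`-multilinear map on `A' ⊗ M`, by extending the linear map `m ↦ f (m, ⋯)` and recursion. -/
noncomputable def multilinearBaseChange (A : Type*) [CommRing A] (A' : Type*) [CommRing A']
    [Algebra A A'] (M : Type*) [AddCommGroup M] [Module A M] (W : Type*) [AddCommGroup W]
    [Module A W] [Module A' W] [IsScalarTower A A' W] :
    (n : ℕ) → MultilinearMap A (fun _ : Fin n => M) W →ₗ[A]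
      MultilinearMap A' (fun _ : Fin n => A' ⊗[A] M) W
  | 0 =>
    { toFun f := MultilinearMap.constOfIsEmpty A' _ (f isEmptyElim)
      map_add' _ _ := rfl
      map_smul' _ _ := rfl }
  | n + 1 =>
    { toFun f := LinearMap.uncurryLeft (M := fun _ : Fin (n + 1) => A' ⊗[A] M)
        (LinearMap.liftBaseChange A' (multilinearBaseChange A A' M W n ∘ₗ f.curryLeft))
      map_add' f g := by
        have : (f + g).curryLeft = f.curryLeft + g.curryLeft := rfl
        rw [this, LinearMap.comp_add]
        refine (congrArg LinearMap.uncurryLeft (map_add (LinearMap.liftBaseChangeEquiv A')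
          (multilinearBaseChange A A' M W n ∘ₗ f.curryLeft)
          (multilinearBaseChange A A' M W n ∘ₗ g.curryLeft))).trans ?_
        rfl
      map_smul' a f := by
        have : (a • f).curryLeft = a • f.curryLeft := rfl
        rw [this, LinearMap.comp_smul]
        refine (congrArg LinearMap.uncurryLeft (LinearMap.map_smul_of_tower
          (LinearMap.liftBaseChangeEquiv A').toLinearMap a
          (multilinearBaseChange A A' M W n ∘ₗ f.curryLeft))).trans ?_
        rfl }

theorem multilinearBaseChange_one_tmul (A : Type*) [CommRing A] (A' : Type*) [CommRing A']
    [Algebra A A'] (M : Type*) [AddCommGroup M] [Module A M] (W : Type*) [AddCommGroup W]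
    [Module A W] [Module A' W] [IsScalarTower A A' W] (n : ℕ)
    (f : MultilinearMap A (fun _ : Fin n => M) W) (m : Fin n → M) :
    multilinearBaseChange A A' M W n f (fun i => 1 ⊗ₜ m i) = f m := by
  induction n with
  | zero => exact congrArg f (Subsingleton.elim _ _)
  | succ n ih =>
    have : multilinearBaseChange A A' M W (n + 1) f (fun i => 1 ⊗ₜ m i) =
      (1 : A') • multilinearBaseChange A A' M W n (f.curryLeft (m 0))
        (fun i => 1 ⊗ₜ Fin.tail m i) := rfl
    rw [this, one_smul, ih]
    exact congrArg f (Fin.cons_self_tail m)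

/-- The inverse is induced by the extension of `(m₁, …, mₙ) ↦ 1 ⊗ (m₁ ⊗ ⋯ ⊗ mₙ)` to an
`A'`-multilinear map. -/
theorem tensorPowerBaseChange_bijective (A : Type*) [CommRing A] (A' : Type*) [CommRing A']
    [Algebra A A'] (M : Type*) [AddCommGroup M] [Module A M] (n : ℕ) :
    Function.Bijective (tensorPowerBaseChange A A' M n) := by
  let F : MultilinearMap A (fun _ : Fin n => M) (A' ⊗[A] (⨂[A]^n M)) :=
    (TensorProduct.mk A A' (⨂[A]^n M) 1).compMultilinearMap (PiTensorProduct.tprod A)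
  let g : ⨂[A']^n (A' ⊗[A] M) →ₗ[A'] A' ⊗[A] (⨂[A]^n M) :=
    PiTensorProduct.lift (multilinearBaseChange A A' M _ n F)
  have hg : ∀ m : Fin n → M, g (⨂ₜ[A'] i, ((1 : A') ⊗ₜ[A] m i)) = 1 ⊗ₜ (⨂ₜ[A] i, m i) := by
    intro m
    simp only [g, PiTensorProduct.lift.tprod, multilinearBaseChange_one_tmul]
    rfl
  refine Function.bijective_iff_has_inverse.2 ⟨g, LinearMap.congr_fun (f := g ∘ₗ
    tensorPowerBaseChange A A' M n) (g := LinearMap.id) ?_, LinearMap.congr_fun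
    (f := tensorPowerBaseChange A A' M n ∘ₗ g) (g := LinearMap.id) ?_⟩
  · refine TensorProduct.AlgebraTensorModule.curry_injective (LinearMap.ext_ring
      (PiTensorProduct.ext (MultilinearMap.ext fun m => ?_)))
    change g (tensorPowerBaseChange A A' M n (1 ⊗ₜ (⨂ₜ[A] i, m i))) = 1 ⊗ₜ (⨂ₜ[A] i, m i)
    rw [tensorPowerBaseChange_tmul_tprod, one_smul, hg]
  · refine PiTensorProduct.ext_of_span_eq_top (γ := fun _ => M)
      (g := fun _ m => (1 : A') ⊗ₜ[A] m) (fun _ => ?_) fun m => ?_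
    · rw [eq_top_iff]
      rintro x -
      induction x using TensorProduct.induction_on with
      | zero => exact Submodule.zero_mem _
      | add x y hx hy => exact Submodule.add_mem _ hx hy
      | tmul a m =>
        have : a ⊗ₜ[A] m = a • ((1 : A') ⊗ₜ[A] m) := by simp [TensorProduct.smul_tmul']
        rw [this]
        exact Submodule.smul_mem _ _ (Submodule.subset_span ⟨m, rfl⟩)
    · rw [LinearMap.comp_apply, hg, tensorPowerBaseChange_tmul_tprod, one_smul, LinearMap.id_apply]

/-! ### The kernel of a map of tensor powers -/

/-- The `n`-fold tensor power `f ⊗ ⋯ ⊗ f` of a linear map. -/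
noncomputable abbrev tensorPowerMap {A P M : Type*} [CommRing A] [AddCommGroup P] [Module A P]
    [AddCommGroup M] [Module A M] (n : ℕ) (f : P →ₗ[A] M) : ⨂[A]^n P →ₗ[A] ⨂[A]^n M :=
  PiTensorProduct.map fun _ => f

section

variable {A P M : Type*} [CommRing A] [AddCommGroup P] [Module A P] [AddCommGroup M] [Module A M]
  {n : ℕ}

theorem tensorPowerMap_comp_permAction (f : P →ₗ[A] M) (σ : Equiv.Perm (Fin n)) :
    tensorPowerMap n f ∘ₗ permAction A P n σ = permAction A M n σ ∘ₗ tensorPowerMap n f := by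
  refine PiTensorProduct.ext (MultilinearMap.ext fun m => ?_)
  simp [permAction_tprod]

/-- Expanding `⨂ (q i + (p i - q i))` leaves, besides `⨂ q i`, only tensors with an entry in `K`. -/
theorem tprod_sub_tprod_mem_span (K : Submodule A P) (p q : Fin n → P)
    (h : ∀ i, p i - q i ∈ K) :
    (⨂ₜ[A] i, p i) - (⨂ₜ[A] i, q i) ∈ Submodule.span A
      {t | ∃ m : Fin n → P, (∃ i, m i ∈ K) ∧ (⨂ₜ[A] i, m i) = t} := by
  classical
  have hp : p = q + (p - q) := by simp
  have := (PiTensorProduct.tprod A (s := fun _ : Fin n => P)).map_add_univ q (p - q)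
  rw [← hp, ← Finset.add_sum_erase _ _ (Finset.mem_univ Finset.univ), Finset.piecewise_univ,
    ← sub_eq_iff_eq_add'] at this
  rw [this]
  refine Submodule.sum_mem _ fun s hs => Submodule.subset_span ⟨_, ?_, rfl⟩
  obtain ⟨i, hi⟩ : ∃ i, i ∉ s := by
    by_contra! hs'
    exact Finset.ne_of_mem_erase hs (Finset.eq_univ_of_forall hs')
  exact ⟨i, by simpa [hi] using h i⟩

/-- A set-theoretic section of `f` induces a linear map from the tensor power of `M` to the quotient
of the tensor power of `P` by the span of the tensors that have an entry in `ker f`. -/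
theorem ker_tensorPowerMap_le (f : P →ₗ[A] M) (hf : Function.Surjective f) :
    LinearMap.ker (tensorPowerMap n f) ≤ Submodule.span A
      {t | ∃ m : Fin n → P, (∃ i, m i ∈ LinearMap.ker f) ∧ (⨂ₜ[A] i, m i) = t} := by
  set R := Submodule.span A
      {t | ∃ m : Fin n → P, (∃ i, m i ∈ LinearMap.ker f) ∧ (⨂ₜ[A] i, m i) = t}
  have hR : ∀ p q : Fin n → P, (∀ i, f (p i) = f (q i)) →
      R.mkQ (⨂ₜ[A] i, p i) = R.mkQ (⨂ₜ[A] i, q i) := fun p q h =>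
    (Submodule.Quotient.eq R).2 (tprod_sub_tprod_mem_span _ p q fun i => by simp [h])
  obtain ⟨s, hs⟩ := hf.hasRightInverse
  let F : MultilinearMap A (fun _ : Fin n => M) ((⨂[A]^n P) ⧸ R) := MultilinearMap.mk'
    (fun m => R.mkQ (⨂ₜ[A] i, s (m i)))
    (fun m i x y => by
      have h : ∀ z, (fun j => s (Function.update m i z j)) =
          Function.update (fun j => s (m j)) i (s z) := fun z => by
        ext j; by_cases hj : j = i
        · subst hj; simp
        · simp [hj]
      rw [h x, h y, ← map_add, ← MultilinearMap.map_update_add]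
      refine hR _ _ fun j => ?_
      by_cases hj : j = i
      · subst hj; simp [hs _]
      · simp [hj])
    (fun m i a x => by
      have h : (fun j => s (Function.update m i x j)) =
          Function.update (fun j => s (m j)) i (s x) := by
        ext j; by_cases hj : j = i
        · subst hj; simp
        · simp [hj]
      rw [h, ← map_smul, ← MultilinearMap.map_update_smul]
      refine hR _ _ fun j => ?_
      by_cases hj : j = i
      · subst hj; simp [hs _]
      · simp [hj])
  have hF : PiTensorProduct.lift F ∘ₗ tensorPowerMap n f = R.mkQ := by
    refine PiTensorProduct.ext (MultilinearMap.ext fun m => ?_)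
    simp only [LinearMap.compMultilinearMap_apply, LinearMap.comp_apply, PiTensorProduct.map_tprod,
      PiTensorProduct.lift.tprod]
    exact hR _ _ fun i => hs _
  intro z hz
  rw [← R.ker_mkQ, ← hF, LinearMap.mem_ker, LinearMap.comp_apply, LinearMap.mem_ker.1 hz, map_zero]

/-- The vanishing of a tensor under `f ⊗ ⋯ ⊗ f` depends on finitely many elements of `ker f` only. -/
theorem exists_finset_of_tensorPowerMap_eq_zero (f : P →ₗ[A] M) (hf : Function.Surjective f)
    (z : ⨂[A]^n P) (hz : tensorPowerMap n f z = 0) :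
    ∃ S : Finset P, (∀ k ∈ S, f k = 0) ∧
      ∀ α : P →ₗ[A] P, (∀ k ∈ S, α k = 0) → tensorPowerMap n α z = 0 := by
  classical
  have hz' := ker_tensorPowerMap_le f hf (LinearMap.mem_ker.2 hz)
  clear hz
  induction hz' using Submodule.span_induction with
  | mem t ht =>
    obtain ⟨m, ⟨i, hi⟩, rfl⟩ := ht
    refine ⟨{m i}, by simpa using hi, fun α hα => ?_⟩
    rw [PiTensorProduct.map_tprod]
    exact MultilinearMap.map_coord_zero _ i (hα _ (Finset.mem_singleton_self _))
  | zero => exact ⟨∅, by simp, by simp⟩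
  | add x y _ _ hx hy =>
    obtain ⟨S, hS, hS'⟩ := hx
    obtain ⟨T, hT, hT'⟩ := hy
    refine ⟨S ∪ T, fun k hk => (Finset.mem_union.1 hk).elim (hS k) (hT k), fun α hα => ?_⟩
    rw [map_add, hS' α fun k hk => hα k (Finset.mem_union_left _ hk),
      hT' α fun k hk => hα k (Finset.mem_union_right _ hk), add_zero]
  | smul a x _ hx =>
    obtain ⟨S, hS, hS'⟩ := hx
    exact ⟨S, hS, fun α hα => by rw [map_smul, hS' α hα, smul_zero]⟩

theorem tensorPowerMap_surjective (f : P →ₗ[A] M) (hf : Function.Surjective f) :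
    Function.Surjective (tensorPowerMap n f) := by
  rw [← LinearMap.range_eq_top, eq_top_iff, ← PiTensorProduct.span_tprod_eq_top,
    Submodule.span_le]
  rintro _ ⟨m, rfl⟩
  choose s hs using hf
  exact ⟨⨂ₜ[A] i, s (m i), by simp [hs]⟩

theorem exists_finset_of_lTensor_tensorPowerMap_eq_zero (N : Type*) [AddCommGroup N] [Module A N]
    (f : P →ₗ[A] M) (hf : Function.Surjective f) (z : N ⊗[A] (⨂[A]^n P))
    (hz : (tensorPowerMap n f).lTensor N z = 0) :
    ∃ S : Finset P, (∀ k ∈ S, f k = 0) ∧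
      ∀ α : P →ₗ[A] P, (∀ k ∈ S, α k = 0) → (tensorPowerMap n α).lTensor N z = 0 := by
  classical
  obtain ⟨w, rfl⟩ := (lTensor_exact N (LinearMap.exact_subtype_ker_map (tensorPowerMap n f))
    (tensorPowerMap_surjective f hf) z).1 hz
  clear hz
  induction w using TensorProduct.induction_on with
  | zero => exact ⟨∅, by simp, by simp⟩
  | add x y hx hy =>
    obtain ⟨S, hS, hS'⟩ := hx
    obtain ⟨T, hT, hT'⟩ := hy
    refine ⟨S ∪ T, fun k hk => (Finset.mem_union.1 hk).elim (hS k) (hT k), fun α hα => ?_⟩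
    rw [map_add, map_add, hS' α fun k hk => hα k (Finset.mem_union_left _ hk),
      hT' α fun k hk => hα k (Finset.mem_union_right _ hk), add_zero]
  | tmul a x =>
    obtain ⟨S, hS, hS'⟩ := exists_finset_of_tensorPowerMap_eq_zero f hf (x : ⨂[A]^n P)
      (LinearMap.mem_ker.1 x.2)
    refine ⟨S, hS, fun α hα => ?_⟩
    rw [LinearMap.lTensor_tmul, LinearMap.lTensor_tmul, Submodule.subtype_apply, hS' α hα,
      TensorProduct.tmul_zero]

/-! ### Flat quotients of free modules -/

/-- The kernel of a surjection `π` from a free module onto a flat module is pure: any finite part of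
it is killed by an endomorphism over `π`. -/
theorem exists_comp_eq_and_apply_eq_zero_of_flat {ι : Type*} [Module.Flat A M]
    (π : (ι →₀ A) →ₗ[A] M) (hπ : Function.Surjective π) (S : Finset (ι →₀ A))
    (hS : ∀ k ∈ S, π k = 0) :
    ∃ α : (ι →₀ A) →ₗ[A] (ι →₀ A), π ∘ₗ α = π ∧ ∀ k ∈ S, α k = 0 := by
  classical
  -- The elements of `S` live in the span of finitely many basis vectors, those indexed by `t`.
  let t : Finset ι := S.biUnion Finsupp.support
  let j : (t →₀ A) →ₗ[A] (ι →₀ A) := Finsupp.lmapDomain A A Subtype.val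
  let q : (ι →₀ A) →ₗ[A] (t →₀ A) := Finsupp.lsubtypeDomain (t : Set ι)
  have hjq : ∀ k ∈ S, j (q k) = k := fun k hk => by
    have hk' : k.support ⊆ t := Finset.subset_biUnion_of_mem Finsupp.support hk
    ext i
    by_cases hi : i ∈ t
    · exact (Finsupp.mapDomain_apply Subtype.val_injective (q k) (⟨i, hi⟩ : t)).trans rfl
    · refine (Finsupp.mapDomain_of_notMem_range _ _ (by simpa using hi)).trans ?_
      exact (Finsupp.notMem_support_iff.1 fun h => hi (hk' h)).symm
  let f : (S →₀ A) →ₗ[A] (t →₀ A) := Finsupp.linearCombination A fun k : S => q k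
  have hf : (π ∘ₗ j) ∘ₗ f = 0 := by
    ext k
    simp [f, hjq k k.2, hS k k.2]
  obtain ⟨l, a, y, hay, haf⟩ := Module.Flat.exists_factorization_of_comp_eq_zero_of_free hf
  obtain ⟨y', hy'⟩ := Module.projective_lifting_property π y hπ
  refine ⟨LinearMap.id - j ∘ₗ q + y' ∘ₗ a ∘ₗ q, ?_, fun k hk => ?_⟩
  · have h1 : π ∘ₗ j ∘ₗ q = π ∘ₗ y' ∘ₗ a ∘ₗ q := by
      rw [← LinearMap.comp_assoc, hay, ← hy']
      rfl
    rw [LinearMap.comp_add, LinearMap.comp_sub, LinearMap.comp_id, h1, sub_add_cancel]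
  · have h2 : a (q k) = 0 := by
      simpa [f] using LinearMap.congr_fun haf (Finsupp.single ⟨k, hk⟩ 1)
    simp [hjq k hk, h2]

end

/-! ### Symmetric tensors of flat modules -/

theorem tensorInvariants_permAction_finsupp (A ι : Type*) [CommRing A] (n : ℕ)
    (N : Type*) [AddCommGroup N] [Module A N] :
    TensorInvariants (V := ⨂[A]^n (ι →₀ A)) (permAction A (ι →₀ A) n) N := by
  let : MulAction (Equiv.Perm (Fin n)) (Fin n → ι) := arrowAction
  refine TensorInvariants.of_basis _ N
    (Basis.piTensorProduct fun _ : Fin n => (Finsupp.basisSingleOne : Module.Basis ι A _))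
    fun σ x => ?_
  rw [Basis.piTensorProduct_apply, Basis.piTensorProduct_apply, permAction_tprod]
  rfl

section

variable {A M : Type*} [CommRing A] [AddCommGroup M] [Module A M] {n : ℕ}

/-- A lift `z` of an invariant tensor need not be invariant, but the elements `σ z - z` die in
the tensor power of `M`, and so they are killed by an endomorphism over `π`, which makes `z`
invariant. -/
theorem exists_invariant_lift_of_flat {ι : Type*} [Module.Flat A M] (π : (ι →₀ A) →ₗ[A] M)
    (hπ : Function.Surjective π) (N : Type*) [AddCommGroup N] [Module A N]
    (y : N ⊗[A] (⨂[A]^n M)) (hy : ∀ σ, (permAction A M n σ).lTensor N y = y) :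
    ∃ z : N ⊗[A] (⨂[A]^n (ι →₀ A)), (∀ σ, (permAction A (ι →₀ A) n σ).lTensor N z = z) ∧
      (tensorPowerMap n π).lTensor N z = y := by
  classical
  obtain ⟨z, rfl⟩ := LinearMap.lTensor_surjective N (tensorPowerMap_surjective (n := n) π hπ) y
  have hz : ∀ σ, (tensorPowerMap n π).lTensor N
      ((permAction A (ι →₀ A) n σ).lTensor N z - z) = 0 := fun σ => by
    rw [map_sub, ← LinearMap.lTensor_comp_apply, tensorPowerMap_comp_permAction,
      LinearMap.lTensor_comp_apply, hy, sub_self]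
  choose S hS hS' using fun σ => exists_finset_of_lTensor_tensorPowerMap_eq_zero N π hπ _ (hz σ)
  obtain ⟨α, hα, hαS⟩ := exists_comp_eq_and_apply_eq_zero_of_flat π hπ (Finset.univ.biUnion S)
    fun k hk => by
      obtain ⟨σ, -, hσ⟩ := Finset.mem_biUnion.1 hk
      exact hS σ k hσ
  refine ⟨(tensorPowerMap n α).lTensor N z, fun σ => ?_, ?_⟩
  · rw [← LinearMap.lTensor_comp_apply, ← tensorPowerMap_comp_permAction,
      LinearMap.lTensor_comp_apply, ← sub_eq_zero, ← map_sub]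
    exact hS' σ α fun k hk => hαS k (Finset.mem_biUnion.2 ⟨σ, Finset.mem_univ _, hk⟩)
  · rw [← LinearMap.lTensor_comp_apply, ← PiTensorProduct.map_comp, hα]

/-- The linear map between the modules of symmetric tensors that is induced by `f`. -/
noncomputable def symmetricTensorsMap {P : Type*} [AddCommGroup P] [Module A P] (n : ℕ)
    (f : P →ₗ[A] M) : symmetricTensors A P n →ₗ[A] symmetricTensors A M n :=
  (tensorPowerMap n f).restrict fun x hx σ => by
    rw [← LinearMap.comp_apply, ← tensorPowerMap_comp_permAction, LinearMap.comp_apply, hx σ]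

theorem subtype_comp_symmetricTensorsMap {P : Type*} [AddCommGroup P] [Module A P]
    (f : P →ₗ[A] M) : (symmetricTensors A M n).subtype ∘ₗ symmetricTensorsMap n f =
      tensorPowerMap n f ∘ₗ (symmetricTensors A P n).subtype :=
  rfl

theorem lid_lTensor_apply {V W : Type*} [AddCommMonoid V] [Module A V] [AddCommMonoid W]
    [Module A W]     (f : V →ₗ[A] W) (x : A ⊗[A] V) :
    TensorProduct.lid A W (f.lTensor A x) = f (TensorProduct.lid A V x) := by
  induction x using TensorProduct.induction_on <;> simp_all

theorem symmetricTensorsMap_surjective_of_flat {ι : Type*} [Module.Flat A M]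
    (π : (ι →₀ A) →ₗ[A] M) (hπ : Function.Surjective π) :
    Function.Surjective (symmetricTensorsMap n π) := by
  intro y
  obtain ⟨z, hz, hzy⟩ := exists_invariant_lift_of_flat π hπ A (1 ⊗ₜ (y : ⨂[A]^n M)) fun σ => by
    rw [LinearMap.lTensor_tmul, y.2 σ]
  refine ⟨⟨TensorProduct.lid A _ z, fun σ => ?_⟩, Subtype.ext ?_⟩
  · rw [← lid_lTensor_apply, hz]
  · change tensorPowerMap n π (TensorProduct.lid A _ z) = y
    rw [← lid_lTensor_apply, hzy, TensorProduct.lid_tmul, one_smul]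

theorem tensorInvariants_permAction_of_flat [Module.Flat A M] (N : Type*) [AddCommGroup N]
    [Module A N] : TensorInvariants (permAction A M n) N := by
  let π : (M →₀ A) →ₗ[A] M := Finsupp.linearCombination A id
  have hπ : Function.Surjective π := Finsupp.linearCombination_id_surjective A M
  have hP := tensorInvariants_permAction_finsupp A M n N
  constructor
  · refine (injective_iff_map_eq_zero _).2 fun w hw => ?_
    obtain ⟨w, rfl⟩ := LinearMap.lTensor_surjective N
      (symmetricTensorsMap_surjective_of_flat (n := n) π hπ) w
    change ((symmetricTensors A M n).subtype.lTensor N) _ = 0 at hw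
    rw [← LinearMap.lTensor_comp_apply, subtype_comp_symmetricTensorsMap,
      LinearMap.lTensor_comp_apply] at hw
    obtain ⟨S, hS, hS'⟩ := exists_finset_of_lTensor_tensorPowerMap_eq_zero N π hπ _ hw
    obtain ⟨α, hα, hαS⟩ := exists_comp_eq_and_apply_eq_zero_of_flat π hπ S hS
    have h := hS' α hαS
    rw [← LinearMap.lTensor_comp_apply, ← subtype_comp_symmetricTensorsMap,
      LinearMap.lTensor_comp_apply] at h
    have h0 : (symmetricTensorsMap n α).lTensor N w = 0 := hP.1 (h.trans (map_zero _).symm)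
    have hcomp : symmetricTensorsMap n π = symmetricTensorsMap n π ∘ₗ symmetricTensorsMap n α := by
      ext x
      change tensorPowerMap n π x = tensorPowerMap n π (tensorPowerMap n α x)
      rw [← LinearMap.comp_apply, ← PiTensorProduct.map_comp, hα]
    rw [hcomp, LinearMap.lTensor_comp_apply, h0]
    exact map_zero _
  · intro y hy
    obtain ⟨z, hz, rfl⟩ := exists_invariant_lift_of_flat π hπ N y hy
    obtain ⟨w, rfl⟩ : z ∈ LinearMap.range ((symmetricTensors A (M →₀ A) n).subtype.lTensor N) :=
      hP.2 z hz
    refine ⟨(symmetricTensorsMap n π).lTensor N w, ?_⟩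
    change ((symmetricTensors A M n).subtype.lTensor N) _ = _
    rw [← LinearMap.lTensor_comp_apply, subtype_comp_symmetricTensorsMap,
      LinearMap.lTensor_comp_apply]

end

/-! ### Base change of symmetric tensors -/

theorem symmetricTensorsBaseChange_bijective_of_tensorInvariants (A : Type*) [CommRing A]
    (A' : Type*) [CommRing A'] [Algebra A A'] (M : Type*) [AddCommGroup M] [Module A M] (n : ℕ)
    (h : TensorInvariants (permAction A M n) A') :
    Function.Bijective (symmetricTensorsBaseChange A A' M n) := by
  have hB := tensorPowerBaseChange_bijective A A' M n
  have hcoe : ∀ x, (symmetricTensorsBaseChange A A' M n x : ⨂[A']^n (A' ⊗[A] M)) =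
      tensorPowerBaseChange A A' M n ((permAction A M n).invariants.subtype.lTensor A' x) :=
    fun _ => rfl
  constructor
  · exact fun x y hxy => h.1 (hB.1 (by rw [← hcoe, ← hcoe, hxy]))
  · intro y
    obtain ⟨z, hz⟩ := hB.2 y
    have hperm : ∀ (σ : Equiv.Perm (Fin n)) (x : A' ⊗[A] (⨂[A]^n M)),
        tensorPowerBaseChange A A' M n ((permAction A M n σ).lTensor A' x) =
          permAction A' (A' ⊗[A] M) n σ (tensorPowerBaseChange A A' M n x) := fun σ x => by
      induction x using TensorProduct.induction_on with
      | zero => simp only [map_zero]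
      | add x y hx hy => simp only [map_add, hx, hy]
      | tmul a x => rw [permAction_tensorPowerBaseChange, LinearMap.lTensor_tmul]
    obtain ⟨w, rfl⟩ := h.2 z fun σ => hB.1 (by rw [hperm, hz, y.2 σ])
    exact ⟨w, Subtype.ext ((hcoe w).trans hz)⟩

theorem mainTheorem10 (A : Type*) [CommRing A] (A' : Type*) [CommRing A'] [Algebra A A']
    (M : Type*) [AddCommGroup M] [Module A M] (n : ℕ) :
    (IsUnit (n.factorial : A) → Function.Bijective (symmetricTensorsBaseChange A A' M n)) ∧
    (Module.Flat A M → Function.Bijective (symmetricTensorsBaseChange A A' M n)) ∧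
    (Module.Flat A A' → Function.Bijective (symmetricTensorsBaseChange A A' M n)) := by
  refine ⟨fun h => ?_, fun h => ?_, fun h => ?_⟩ <;>
    refine symmetricTensorsBaseChange_bijective_of_tensorInvariants A A' M n ?_
  · exact TensorInvariants.of_isUnit_card _ A' (by rwa [Fintype.card_perm, Fintype.card_fin])
  · exact tensorInvariants_permAction_of_flat A'
  · exact TensorInvariants.of_flat _ A'
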